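/- Let $0<\varepsilon\le 1$ and $1<p\le 2$, and set $c(\varepsilon,p)=\frac14\,\varepsilon^{\frac{2(p+1)}{p}}(p-1)$. Let $n$ be a positive integer with $n\ge 2/c(\varepsilon,p)$, and let $(\boldsymbol\Omega,\mathcal F,\mathbf P)$ be the product of a finite sequence $(\Omega_1,\mathcal F_1,\mathbb P_1),\dots,(\Omega_n,\mathcal F_n,\mathbb P_n)$ of probability spaces. For nonempty $I\subseteq\{1,\dots,n\}$ let $(\boldsymbol\Omega_I,\mathcal F_I,\mathbf P_I)$ denote the product of the spaces $(\Omega_i,\mathcal F_i,\mathbb P_i)$, $i\in I$. If $I$ and $I^{\mathsf c}=\{1,\dots,n\}\setminus I$ are nonempty, $f\colon\boldsymbol\Omega\to\mathbb R$ and $\mathbf x\in\boldsymbol\Omega_I$, let $f_{\mathbf x}\colon\boldsymbol\Omega_{I^{\mathsf c}}\to\mathbb R$, $f_{\mathbf x}(\mathbf y)=f\big((\mathbf x,\mathbf y)\big)$, be the section of $f$ at $\mathbf x$. Write $\mathbb E(f)=\int f\,d\mathbf P$ and $\mathbb E(f_{\mathbf x})=\int f_{\mathbf x}\,d\mathbf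 P_{I^{\mathsf c}}$; the latter is defined when $f_{\mathbf x}$ is integrable. Then for every $f\in L_p(\boldsymbol\Omega,\mathcal F,\mathbf P)$ with $\|f\|_{L_p}\le 1$ there exists an interval $J$ of $\{1,\dots,n\}$ (a set of consecutive integers) with $J^{\mathsf c}\ne\emptyset$ and $|J|\ge c(\varepsilon,p)\,n$ such that for every nonempty $I\subseteq J$ we have $$\mathbf P_I\big(\{\mathbf x\in\boldsymbol\Omega_I: f_{\mathbf x}\text{ is integrable and } |\mathbb E(f_{\mathbf x})-\mathbb E(f)|\le\varepsilon\}\big)\ge 1-\varepsilon .$$ -/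

import Mathlib

open MeasureTheory

/-- The constant `c(ε, p) = (1/4) ε ^ (2(p+1)/p) (p - 1)`. -/
noncomputable def concConst (ε p : ℝ) : ℝ :=
  (1 / 4) * ε ^ (2 * (p + 1) / p) * (p - 1)

/-- The point `(x, y)` of the full product `∏ i, Ω i` with coordinates `x` on `I` and
coordinates `y` on the complement of `I`. -/
def gluePoint {n : ℕ} {Ω : Fin n → Type*} (I : Finset (Fin n))
    (x : (i : {i : Fin n // i ∈ I}) → Ω i) (y : (i : {i : Fin n // i ∉ I}) → Ω i) :
    (i : Fin n) → Ω i :=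
  fun i => if h : i ∈ I then x ⟨i, h⟩ else y ⟨i, h⟩

/-- The section `f_x` of `f` at a point `x` of the partial product over `I`; it is a function on
the partial product over the complement of `I`. -/
def sectionAt {n : ℕ} {Ω : Fin n → Type*} (I : Finset (Fin n)) (f : ((i : Fin n) → Ω i) → ℝ)
    (x : (i : {i : Fin n // i ∈ I}) → Ω i) :
    ((i : {i : Fin n // i ∉ I}) → Ω i) → ℝ :=
  fun y => f (gluePoint I x y)

/-!
The proof splits `{1, …, n}` into consecutive blocks and follows the martingale of conditional
expectations of `f` on the coordinates in the first `k` blocks. For `1 < p ≤ 2` its differences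
`d_k` satisfy `(p - 1) * ∑ ‖d_k‖ ^ 2 ≤ ‖f‖ ^ 2 ≤ 1` in `L_p` (`sum_lpNorm_condExp_sub_sq_le`), so
with `m` blocks some difference has `‖d_k‖ ^ 2 ≤ 1 / ((p - 1) * m)`; that block is `J`.

If `I ⊆ J`, then conditioning `d_k` on the coordinates in `I` gives `𝔼[f | I] - 𝔼[f]`: the larger
σ-algebra contains the one of `I`, and the smaller one is independent of it. Conditional
expectation is a contraction of `L_p`, so `‖𝔼[f | I] - 𝔼[f]‖ ≤ ‖d_k‖`
(`lpNorm_condExp_sub_integral_le`). By Fubini `𝔼[f | I]` is the average of the sections of `f`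
(`integral_sectionAt_ae_eq_condExp`), and Markov's inequality gives the conclusion as soon as
`‖d_k‖ ≤ ε ^ ((p + 1) / p)`, that is, as soon as `m ≥ 1 / (4 * c(ε, p))`.

The square function bound rests on the one-sided Pythagorean inequality
`‖𝔼[F | m]‖ ^ 2 + (p - 1) * ‖F - 𝔼[F | m]‖ ^ 2 ≤ ‖F‖ ^ 2` (`lpNorm_condExp_sq_add_le`), which
follows from the 2-uniform convexity of `L_p` with constant `p - 1` (`lpNorm_sq_add_le`) by
repeatedly halving the perturbation `F - 𝔼[F | m]` of `𝔼[F | m]`. Uniform convexity in turn is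
the integrated form of a two-point inequality (`rpow_half_le_abs_add_rpow_add_abs_sub_rpow`).
-/

/-! ### The two-point inequality -/

lemma sq_rpow_half {p t : ℝ} (ht : 0 ≤ t) : (t ^ 2) ^ (p / 2) = t ^ p := by
  rw [← Real.rpow_natCast, ← Real.rpow_mul ht]
  congr 1
  push_cast
  ring

/-- The derivative in `x` of the difference of the two sides is nonnegative by AM-GM. -/
lemma two_mul_le_one_add_rpow_sub_one_sub_rpow {r x : ℝ} (hr0 : 0 < r) (hr1 : r ≤ 1)
    (hx0 : 0 ≤ x) (hx1 : x ≤ 1) :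
    2 * r * x ≤ (1 + x) ^ r - (1 - x) ^ r := by
  have hmono : MonotoneOn (fun t : ℝ => (1 + t) ^ r - (1 - t) ^ r - 2 * r * t)
      (Set.Icc 0 1) := by
    have hderiv : ∀ t ∈ Set.Ioo (0 : ℝ) 1,
        HasDerivAt (fun t : ℝ => (1 + t) ^ r - (1 - t) ^ r - 2 * r * t)
          (1 * r * (1 + t) ^ (r - 1) - -1 * r * (1 - t) ^ (r - 1) - 2 * r * 1) t := by
      intro t ht
      have h1 := ((hasDerivAt_id t).const_add 1).rpow_const (p := r)
        (Or.inl (by simp only [id]; linarith [ht.1]))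
      have h2 := ((hasDerivAt_id t).const_sub 1).rpow_const (p := r)
        (Or.inl (by simp only [id]; linarith [ht.2]))
      exact (h1.sub h2).sub ((hasDerivAt_id t).const_mul (2 * r))
    refine monotoneOn_of_deriv_nonneg (convex_Icc 0 1) ?_ ?_ ?_
    · refine ContinuousOn.sub (ContinuousOn.sub ?_ ?_) (by fun_prop)
      · exact ContinuousOn.rpow_const (by fun_prop) fun _ _ => Or.inr hr0.le
      · exact ContinuousOn.rpow_const (by fun_prop) fun _ _ => Or.inr hr0.le
    · rw [interior_Icc]
      exact fun t ht => (hderiv t ht).differentiableAt.differentiableWithinAt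
    · rw [interior_Icc]
      intro t ht
      rw [(hderiv t ht).deriv]
      set a := (1 + t) ^ (r - 1)
      set b := (1 - t) ^ (r - 1)
      have ha : 0 < a := Real.rpow_pos_of_pos (by linarith [ht.1]) _
      have hb : 0 < b := Real.rpow_pos_of_pos (by linarith [ht.2]) _
      -- AM-GM: the product of the two powers is `(1 - t ^ 2) ^ (r - 1) ≥ 1`.
      have hab : 1 ≤ a * b := by
        rw [← Real.mul_rpow (by linarith [ht.1]) (by linarith [ht.2])]
        exact Real.one_le_rpow_of_pos_of_le_one_of_nonpos (by nlinarith [ht.1, ht.2])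
          (by nlinarith [ht.1, ht.2]) (by linarith)
      have : 2 ≤ a + b := by nlinarith [sq_nonneg (a - b)]
      nlinarith
  have h := hmono (Set.left_mem_Icc.2 zero_le_one) ⟨hx0, hx1⟩ hx0
  simp at h
  linarith

/-- Second-order Taylor bound. The derivative in `x` of the difference of the two sides is handled
by the previous lemma with `r = p - 1`. -/
lemma two_add_le_one_add_rpow_add_one_sub_rpow {p x : ℝ} (hp1 : 1 < p) (hp2 : p ≤ 2)
    (hx0 : 0 ≤ x) (hx1 : x ≤ 1) :
    2 + p * (p - 1) * x ^ 2 ≤ (1 + x) ^ p + (1 - x) ^ p := by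
  have hmono : MonotoneOn (fun t : ℝ => (1 + t) ^ p + (1 - t) ^ p - p * (p - 1) * t ^ 2)
      (Set.Icc 0 1) := by
    have hderiv : ∀ t ∈ Set.Ioo (0 : ℝ) 1,
        HasDerivAt (fun t : ℝ => (1 + t) ^ p + (1 - t) ^ p - p * (p - 1) * t ^ 2)
          (1 * p * (1 + t) ^ (p - 1) + -1 * p * (1 - t) ^ (p - 1)
            - p * (p - 1) * (2 * t)) t := by
      intro t ht
      have h1 := ((hasDerivAt_id t).const_add 1).rpow_const (p := p)
        (Or.inl (by simp only [id]; linarith [ht.1]))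
      have h2 := ((hasDerivAt_id t).const_sub 1).rpow_const (p := p)
        (Or.inl (by simp only [id]; linarith [ht.2]))
      have h3 : HasDerivAt (fun t : ℝ => t ^ 2) (2 * t) t := by simpa using hasDerivAt_pow 2 t
      exact (h1.add h2).sub (h3.const_mul (p * (p - 1)))
    refine monotoneOn_of_deriv_nonneg (convex_Icc 0 1) ?_ ?_ ?_
    · refine ContinuousOn.sub (ContinuousOn.add ?_ ?_) (by fun_prop)
      · exact ContinuousOn.rpow_const (by fun_prop) fun _ _ => Or.inr (by linarith)
      · exact ContinuousOn.rpow_const (by fun_prop) fun _ _ => Or.inr (by linarith)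
    · rw [interior_Icc]
      exact fun t ht => (hderiv t ht).differentiableAt.differentiableWithinAt
    · rw [interior_Icc]
      intro t ht
      rw [(hderiv t ht).deriv]
      have := two_mul_le_one_add_rpow_sub_one_sub_rpow (r := p - 1) (by linarith) (by linarith)
        ht.1.le ht.2.le
      nlinarith
  have h := hmono (Set.left_mem_Icc.2 zero_le_one) ⟨hx0, hx1⟩ hx0
  simp at h
  linarith

lemma rpow_half_le_of_le {p a b : ℝ} (hp1 : 1 < p) (hp2 : p ≤ 2) (hb : 0 ≤ b) (hba : b ≤ a) :
    (a ^ 2 + (p - 1) * b ^ 2) ^ (p / 2) ≤ ((a + b) ^ p + (a - b) ^ p) / 2 := by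
  rcases (hb.trans hba).eq_or_lt with ha | ha
  · obtain rfl : b = 0 := le_antisymm (ha ▸ hba) hb
    simp [← ha, Real.zero_rpow (by linarith : p ≠ 0), Real.zero_rpow (by linarith : p / 2 ≠ 0)]
  have hx0 : 0 ≤ b / a := by positivity
  have hx1 : b / a ≤ 1 := (div_le_one ha).2 hba
  set x := b / a with hx
  have hbx : b = a * x := by rw [hx]; field_simp
  have key : (1 + (p - 1) * x ^ 2) ^ (p / 2) ≤ ((1 + x) ^ p + (1 - x) ^ p) / 2 := by
    -- Bernoulli's inequality linearizes the left side, as `p / 2 ≤ 1`.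
    have h1 := rpow_one_add_le_one_add_mul_self (s := (p - 1) * x ^ 2) (p := p / 2)
      (by nlinarith [sq_nonneg x]) (by linarith) (by linarith)
    have h2 := two_add_le_one_add_rpow_add_one_sub_rpow hp1 hp2 hx0 hx1
    linarith
  have e1 : a ^ 2 + (p - 1) * b ^ 2 = a ^ 2 * (1 + (p - 1) * x ^ 2) := by rw [hbx]; ring
  have e2 : a + b = a * (1 + x) := by rw [hbx]; ring
  have e3 : a - b = a * (1 - x) := by rw [hbx]; ring
  rw [e1, e2, e3, Real.mul_rpow (by positivity) (by nlinarith [sq_nonneg x]),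
    Real.mul_rpow ha.le (by linarith), Real.mul_rpow ha.le (by linarith),
    sq_rpow_half ha.le]
  have := Real.rpow_pos_of_pos ha p
  nlinarith

/-- The two-point inequality: for `1 < p ≤ 2` the `L_p` norm of a Rademacher sum `a ± b`
dominates `√(a ^ 2 + (p - 1) * b ^ 2)`. -/
lemma rpow_half_le_abs_add_rpow_add_abs_sub_rpow {p : ℝ} (hp1 : 1 < p) (hp2 : p ≤ 2) (a b : ℝ) :
    (a ^ 2 + (p - 1) * b ^ 2) ^ (p / 2) ≤ (|a + b| ^ p + |a - b| ^ p) / 2 := by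
  have habs : ∀ a b : ℝ, |b| ≤ |a| →
      (|a| + |b|) ^ p + (|a| - |b|) ^ p = |a + b| ^ p + |a - b| ^ p := by
    intro a b hab
    rcases abs_cases a with ⟨ha, ha'⟩ | ⟨ha, ha'⟩ <;>
    rcases abs_cases b with ⟨hb, hb'⟩ | ⟨hb, hb'⟩ <;>
    rcases abs_cases (a + b) with ⟨hs, hs'⟩ | ⟨hs, hs'⟩ <;>
    rcases abs_cases (a - b) with ⟨hd, hd'⟩ | ⟨hd, hd'⟩ <;>
    rw [hs, hd, ha, hb] <;>
    first
      | (congr 2 <;> linarith)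
      | (rw [add_comm]; congr 2 <;> linarith)
  rcases le_total |b| |a| with h | h
  · have := rpow_half_le_of_le hp1 hp2 (abs_nonneg b) h
    rwa [habs a b h, sq_abs, sq_abs] at this
  · -- Exchanging the roles of `a` and `b` costs nothing, since `p - 1 ≤ 1`.
    have := rpow_half_le_of_le hp1 hp2 (abs_nonneg a) h
    rw [habs b a h, sq_abs, sq_abs, add_comm b a, abs_sub_comm b a] at this
    refine le_trans (Real.rpow_le_rpow ?_ ?_ (by linarith)) this
    · nlinarith [sq_nonneg a, sq_nonneg b]
    · have := sq_le_sq.2 h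
      nlinarith

/-! ### Uniform convexity of `L_p` -/

lemma lpNorm_congr_of_ae_eq {α : Type*} {m : MeasurableSpace α} {μ : Measure α} {q : ENNReal}
    {F G : α → ℝ} (h : F =ᵐ[μ] G) : lpNorm F q μ = lpNorm G q μ := by
  by_cases hF : AEStronglyMeasurable F μ
  · rw [← toReal_eLpNorm hF, ← toReal_eLpNorm (hF.congr h), eLpNorm_congr_ae h]
  · rw [lpNorm_of_not_aestronglyMeasurable hF,
      lpNorm_of_not_aestronglyMeasurable fun hG => hF (hG.congr h.symm)]

lemma lpNorm_rpow_eq_integral {α : Type*} {m : MeasurableSpace α} {μ : Measure α} {p : ℝ}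
    (hp : 1 < p) {F : α → ℝ} (hF : MemLp F (ENNReal.ofReal p) μ) :
    lpNorm F (ENNReal.ofReal p) μ ^ p = ∫ x, |F x| ^ p ∂μ := by
  rw [lpNorm_eq_integral_norm_rpow_toReal (by simp; linarith) (by simp) hF.1,
    ENNReal.toReal_ofReal (by linarith), ← Real.rpow_mul (by positivity),
    inv_mul_cancel₀ (by linarith), Real.rpow_one]
  rfl

lemma integrable_abs_rpow {α : Type*} {m : MeasurableSpace α} {μ : Measure α} {p : ℝ}
    (hp : 1 < p) {F : α → ℝ} (hF : MemLp F (ENNReal.ofReal p) μ) :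
    Integrable (fun x => |F x| ^ p) μ := by
  have := hF.integrable_norm_rpow (by simp; linarith) (by simp)
  rwa [ENNReal.toReal_ofReal (by linarith)] at this

/-- A weighted power mean inequality. The weights `A ^ 2 / S` and `c * B ^ 2 / S` make it an
equality at `(u, v) = (A, B)`. -/
lemma weighted_rpow_le {p A B c u v : ℝ} (hp1 : 1 < p) (hp2 : p ≤ 2) (hA : 0 < A) (hB : 0 < B)
    (hc : 0 ≤ c) (hu : 0 ≤ u) (hv : 0 ≤ v) :
    (A ^ 2 + c * B ^ 2) ^ (p / 2) * (A ^ 2 / (A ^ 2 + c * B ^ 2) / A ^ p * u ^ p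
      + c * B ^ 2 / (A ^ 2 + c * B ^ 2) / B ^ p * v ^ p) ≤ (u ^ 2 + c * v ^ 2) ^ (p / 2) := by
  set S := A ^ 2 + c * B ^ 2 with hS
  have hS0 : 0 < S := by positivity
  have h := (Real.concaveOn_rpow (p := p / 2) (by linarith) (by linarith)).2
    (sq_nonneg (u / A)) (sq_nonneg (v / B))
    (show 0 ≤ A ^ 2 / S by positivity) (show 0 ≤ c * B ^ 2 / S by positivity)
    (by rw [← add_div, ← hS, div_self hS0.ne'])
  simp only [smul_eq_mul] at h
  rw [sq_rpow_half (by positivity), sq_rpow_half (by positivity), Real.div_rpow hu hA.le,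
    Real.div_rpow hv hB.le] at h
  have e : A ^ 2 / S * (u / A) ^ 2 + c * B ^ 2 / S * (v / B) ^ 2 = (u ^ 2 + c * v ^ 2) / S := by
    field_simp
  rw [e, Real.div_rpow (by positivity) hS0.le, le_div_iff₀ (by positivity)] at h
  refine le_trans (le_of_eq ?_) h
  ring

/-- The Ball–Carlen–Lieb inequality: `L_p` is 2-uniformly convex, with constant `p - 1`, for
`1 < p ≤ 2`. -/
theorem lpNorm_sq_add_le {α : Type*} {m : MeasurableSpace α} {μ : Measure α} {p : ℝ}
    (hp1 : 1 < p) (hp2 : p ≤ 2) {F G : α → ℝ} (hF : MemLp F (ENNReal.ofReal p) μ)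
    (hG : MemLp G (ENNReal.ofReal p) μ) :
    2 * lpNorm F (ENNReal.ofReal p) μ ^ 2 + 2 * (p - 1) * lpNorm G (ENNReal.ofReal p) μ ^ 2 ≤
      lpNorm (F + G) (ENNReal.ofReal p) μ ^ 2 + lpNorm (F - G) (ENNReal.ofReal p) μ ^ 2 := by
  have hp0 : ENNReal.ofReal p ≠ 0 := by simp; linarith
  set A := lpNorm F (ENNReal.ofReal p) μ with hA
  set B := lpNorm G (ENNReal.ofReal p) μ with hB
  set X := lpNorm (F + G) (ENNReal.ofReal p) μ
  set Y := lpNorm (F - G) (ENNReal.ofReal p) μ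
  have hA0 : 0 ≤ A := lpNorm_nonneg
  have hB0 : 0 ≤ B := lpNorm_nonneg
  have hX0 : 0 ≤ X := lpNorm_nonneg
  have hY0 : 0 ≤ Y := lpNorm_nonneg
  -- The weights in `weighted_rpow_le` need `A, B > 0`; if `A = 0` or `B = 0` then `X = Y`.
  rcases hA0.eq_or_lt with hA' | hA'
  · have hF0 : F =ᵐ[μ] 0 := (lpNorm_eq_zero hF hp0).1 hA'.symm
    have h1 : X = B := lpNorm_congr_of_ae_eq (by filter_upwards [hF0] with x hx; simp [hx])
    have h2 : Y = B := by
      rw [hB, ← lpNorm_neg]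
      exact lpNorm_congr_of_ae_eq (by filter_upwards [hF0] with x hx; simp [hx])
    rw [h1, h2, ← hA']
    nlinarith [sq_nonneg B]
  rcases hB0.eq_or_lt with hB' | hB'
  · have hG0 : G =ᵐ[μ] 0 := (lpNorm_eq_zero hG hp0).1 hB'.symm
    have h1 : X = A := lpNorm_congr_of_ae_eq (by filter_upwards [hG0] with x hx; simp [hx])
    have h2 : Y = A := lpNorm_congr_of_ae_eq (by filter_upwards [hG0] with x hx; simp [hx])
    rw [h1, h2, ← hB']
    linarith [sq_nonneg A]
  have hc : 0 ≤ p - 1 := by linarith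
  have hS0 : 0 < A ^ 2 + (p - 1) * B ^ 2 := by positivity
  have hint : (A ^ 2 + (p - 1) * B ^ 2) ^ (p / 2) ≤ (X ^ p + Y ^ p) / 2 := by
    have hpt : ∀ x, (A ^ 2 + (p - 1) * B ^ 2) ^ (p / 2) *
        (A ^ 2 / (A ^ 2 + (p - 1) * B ^ 2) / A ^ p * |F x| ^ p
          + (p - 1) * B ^ 2 / (A ^ 2 + (p - 1) * B ^ 2) / B ^ p * |G x| ^ p) ≤
        (|(F + G) x| ^ p + |(F - G) x| ^ p) / 2 := fun x => by
      refine (weighted_rpow_le hp1 hp2 hA' hB' hc (abs_nonneg _) (abs_nonneg _)).trans ?_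
      rw [sq_abs, sq_abs]
      exact rpow_half_le_abs_add_rpow_add_abs_sub_rpow hp1 hp2 _ _
    have iF := integrable_abs_rpow hp1 hF
    have iG := integrable_abs_rpow hp1 hG
    have iX := integrable_abs_rpow hp1 (hF.add hG)
    have iY := integrable_abs_rpow hp1 (hF.sub hG)
    have h : ∫ x, (A ^ 2 + (p - 1) * B ^ 2) ^ (p / 2) *
        (A ^ 2 / (A ^ 2 + (p - 1) * B ^ 2) / A ^ p * |F x| ^ p
          + (p - 1) * B ^ 2 / (A ^ 2 + (p - 1) * B ^ 2) / B ^ p * |G x| ^ p) ∂μ ≤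
        ∫ x, (|(F + G) x| ^ p + |(F - G) x| ^ p) / 2 ∂μ :=
      integral_mono (((iF.const_mul _).add (iG.const_mul _)).const_mul _)
        ((iX.add iY).div_const 2) hpt
    rw [integral_const_mul, integral_div, integral_add (iF.const_mul _) (iG.const_mul _),
      integral_const_mul, integral_const_mul, integral_add iX iY,
      ← lpNorm_rpow_eq_integral hp1 hF, ← lpNorm_rpow_eq_integral hp1 hG,
      ← lpNorm_rpow_eq_integral hp1 (hF.add hG), ← lpNorm_rpow_eq_integral hp1 (hF.sub hG)] at h
    refine le_trans (le_of_eq ?_) h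
    have := Real.rpow_pos_of_pos hA' p
    have := Real.rpow_pos_of_pos hB' p
    rw [← hA, ← hB, div_mul_cancel₀ _ (by positivity), div_mul_cancel₀ _ (by positivity),
      ← add_div, div_self hS0.ne', mul_one]
  -- The power mean inequality between the exponents `p ≤ 2`.
  have hmean : (X ^ p + Y ^ p) / 2 ≤ ((X ^ 2 + Y ^ 2) / 2) ^ (p / 2) := by
    have h := (Real.concaveOn_rpow (p := p / 2) (by linarith) (by linarith)).2
      (sq_nonneg X) (sq_nonneg Y)
      (show (0 : ℝ) ≤ 1 / 2 by norm_num) (show (0 : ℝ) ≤ 1 / 2 by norm_num) (by norm_num)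
    simp only [smul_eq_mul] at h
    rw [sq_rpow_half hX0, sq_rpow_half hY0] at h
    rwa [add_div, add_div, div_eq_inv_mul, div_eq_inv_mul, div_eq_inv_mul, div_eq_inv_mul,
      ← one_div]
  have := (Real.rpow_le_rpow_iff hS0.le (by positivity) (by linarith)).1 (hint.trans hmean)
  linarith

/-! ### Martingale differences in `L_p` -/

/-- Perturbing an `m`-measurable function `a` by a `d` with vanishing conditional expectation
increases the `L_p` norm quantitatively. The constant at `k + 1` follows from the constant at `k`
by applying 2-uniform convexity to `a` and `a + d`, with midpoint `a + d / 2`, and the induction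
hypothesis to `d / 2`. -/
lemma lpNorm_sq_add_mul_le_of_condExp_eq_zero {α : Type*} {m m0 : MeasurableSpace α}
    {μ : Measure α} [IsFiniteMeasure μ] {p : ℝ} (hp1 : 1 < p) (hp2 : p ≤ 2) (hm : m ≤ m0)
    {a : α → ℝ} (ha : MemLp a (ENNReal.ofReal p) μ) (ham : StronglyMeasurable[m] a) (k : ℕ) :
    ∀ d : α → ℝ, MemLp d (ENNReal.ofReal p) μ → μ[d | m] =ᵐ[μ] 0 →
      lpNorm a (ENNReal.ofReal p) μ ^ 2
        + (p - 1) * (1 - (1 / 2) ^ k) * lpNorm d (ENNReal.ofReal p) μ ^ 2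
        ≤ lpNorm (a + d) (ENNReal.ofReal p) μ ^ 2 := by
  have hq : 1 ≤ ENNReal.ofReal p := by simpa using hp1.le
  induction k with
  | zero =>
    intro d hd hd0
    have h1 : μ[a + d | m] =ᵐ[μ] a := by
      filter_upwards [condExp_add (ha.integrable hq) (hd.integrable hq) m, hd0] with x hx hx0
      rw [hx, Pi.add_apply, hx0, condExp_of_stronglyMeasurable hm ham (ha.integrable hq)]
      simp
    have h2 : lpNorm a (ENNReal.ofReal p) μ ≤ lpNorm (a + d) (ENNReal.ofReal p) μ := by
      rw [← lpNorm_congr_of_ae_eq h1]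
      exact (ha.add hd).lpNorm_condExp_le_lpNorm hq
    have h3 : 0 ≤ lpNorm a (ENNReal.ofReal p) μ := lpNorm_nonneg
    simpa using pow_le_pow_left₀ h3 h2 2
  | succ k ih =>
    intro d hd hd0
    have hh : MemLp ((1 / 2 : ℝ) • d) (ENNReal.ofReal p) μ := hd.const_smul _
    have hh0 : μ[(1 / 2 : ℝ) • d | m] =ᵐ[μ] 0 := by
      filter_upwards [condExp_smul (1 / 2 : ℝ) d m (μ := μ), hd0] with x hx hx0
      rw [hx, Pi.smul_apply, hx0]
      simp
    have h1 := ih _ hh hh0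
    have h2 := lpNorm_sq_add_le hp1 hp2 (ha.add hh) hh
    have e1 : a + (1 / 2 : ℝ) • d + (1 / 2 : ℝ) • d = a + d := by
      rw [add_assoc, ← add_smul]; norm_num
    have e2 : lpNorm ((1 / 2 : ℝ) • d) (ENNReal.ofReal p) μ
        = 1 / 2 * lpNorm d (ENNReal.ofReal p) μ := by
      rw [lpNorm_const_smul]; norm_num
    rw [e1, add_sub_cancel_right, e2] at h2
    rw [e2] at h1
    rw [pow_succ (1 / 2 : ℝ)]
    nlinarith

/-- Orthogonality up to the factor `p - 1`: in `L_p`, `1 < p ≤ 2`, a function and its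
conditional expectation satisfy a one-sided Pythagorean inequality. -/
theorem lpNorm_condExp_sq_add_le {α : Type*} {m m0 : MeasurableSpace α}
    {μ : Measure α} [IsFiniteMeasure μ] {p : ℝ} (hp1 : 1 < p) (hp2 : p ≤ 2) (hm : m ≤ m0)
    {F : α → ℝ} (hF : MemLp F (ENNReal.ofReal p) μ) :
    lpNorm (μ[F | m]) (ENNReal.ofReal p) μ ^ 2
      + (p - 1) * lpNorm (F - μ[F | m]) (ENNReal.ofReal p) μ ^ 2
      ≤ lpNorm F (ENNReal.ofReal p) μ ^ 2 := by
  have hq : 1 ≤ ENNReal.ofReal p := by simpa using hp1.le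
  have hcF : MemLp (μ[F | m]) (ENNReal.ofReal p) μ := hF.condExp hq
  have hd0 : μ[F - μ[F | m] | m] =ᵐ[μ] 0 := by
    filter_upwards [condExp_sub (hF.integrable hq) (hcF.integrable hq) m] with x hx
    rw [hx, Pi.sub_apply, condExp_of_stronglyMeasurable hm stronglyMeasurable_condExp
      integrable_condExp]
    simp
  have h := fun k => lpNorm_sq_add_mul_le_of_condExp_eq_zero hp1 hp2 hm hcF
    stronglyMeasurable_condExp k _ (hF.sub hcF) hd0
  simp only [add_sub_cancel] at h
  have ht : Filter.Tendsto (fun k : ℕ => lpNorm (μ[F | m]) (ENNReal.ofReal p) μ ^ 2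
        + (p - 1) * (1 - (1 / 2 : ℝ) ^ k) * lpNorm (F - μ[F | m]) (ENNReal.ofReal p) μ ^ 2)
      Filter.atTop (nhds (lpNorm (μ[F | m]) (ENNReal.ofReal p) μ ^ 2
        + (p - 1) * (1 - 0) * lpNorm (F - μ[F | m]) (ENNReal.ofReal p) μ ^ 2)) := by
    have := tendsto_pow_atTop_nhds_zero_of_lt_one (r := (1 / 2 : ℝ)) (by norm_num) (by norm_num)
    exact (((this.const_sub 1).const_mul _).mul_const _).const_add _
  have := le_of_tendsto' ht h
  simpa using this

/-- The martingale differences of `F` along a filtration are square summable in `L_p`. -/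
theorem sum_lpNorm_condExp_sub_sq_le {α : Type*} {m0 : MeasurableSpace α}
    {μ : Measure α} [IsFiniteMeasure μ] {p : ℝ} (hp1 : 1 < p) (hp2 : p ≤ 2)
    {G : ℕ → MeasurableSpace α} (hG : Monotone G) (hG0 : ∀ k, G k ≤ m0)
    {F : α → ℝ} (hF : MemLp F (ENNReal.ofReal p) μ) (m : ℕ) :
    (p - 1) * ∑ k ∈ Finset.range m,
        lpNorm (μ[F | G (k + 1)] - μ[F | G k]) (ENNReal.ofReal p) μ ^ 2
      ≤ lpNorm F (ENNReal.ofReal p) μ ^ 2 := by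
  have hq : 1 ≤ ENNReal.ofReal p := by simpa using hp1.le
  have key : (p - 1) * ∑ k ∈ Finset.range m,
        lpNorm (μ[F | G (k + 1)] - μ[F | G k]) (ENNReal.ofReal p) μ ^ 2
      ≤ lpNorm (μ[F | G m]) (ENNReal.ofReal p) μ ^ 2 := by
    induction m with
    | zero => simp
    | succ m ih =>
      have htower := condExp_condExp_of_le (f := F) (μ := μ) (hG m.le_succ) (hG0 (m + 1))
      have h := lpNorm_condExp_sq_add_le hp1 hp2 (hG0 m)
        (hF.condExp (m := G (m + 1)) hq)
      rw [lpNorm_congr_of_ae_eq htower, lpNorm_congr_of_ae_eq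
        ((Filter.EventuallyEq.refl _ (μ[F | G (m + 1)])).sub htower)] at h
      rw [Finset.sum_range_succ]
      linarith
  refine key.trans (pow_le_pow_left₀ lpNorm_nonneg (hF.lpNorm_condExp_le_lpNorm hq) 2)

/-- By pigeonhole, one of the first `m` martingale differences is at most of average size. -/
lemma exists_lpNorm_condExp_sub_sq_le {α : Type*} {m0 : MeasurableSpace α}
    {μ : Measure α} [IsFiniteMeasure μ] {p : ℝ} (hp1 : 1 < p) (hp2 : p ≤ 2)
    {G : ℕ → MeasurableSpace α} (hG : Monotone G) (hG0 : ∀ k, G k ≤ m0)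
    {F : α → ℝ} (hF : MemLp F (ENNReal.ofReal p) μ) {m : ℕ} (hm : m ≠ 0) :
    ∃ k < m, (p - 1) * m * lpNorm (μ[F | G (k + 1)] - μ[F | G k]) (ENNReal.ofReal p) μ ^ 2
      ≤ lpNorm F (ENNReal.ofReal p) μ ^ 2 := by
  have h := sum_lpNorm_condExp_sub_sq_le hp1 hp2 hG hG0 hF m
  by_contra! hcon
  have hsum := Finset.sum_lt_sum_of_nonempty (Finset.nonempty_range_iff.2 hm)
    fun k hk => hcon k (Finset.mem_range.1 hk)
  rw [Finset.sum_const, Finset.card_range, nsmul_eq_mul, ← Finset.mul_sum] at hsum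
  have hm' : (0 : ℝ) < m := by positivity
  nlinarith

/-- A martingale increment `𝔼[F | m₂] - 𝔼[F | m₁]` controls the oscillation of `𝔼[F | m]` for
every sub-σ-algebra `m` of `m₂` that is independent of `m₁`: conditioning the increment on `m`
gives `𝔼[F | m] - 𝔼[F]`. -/
lemma lpNorm_condExp_sub_integral_le {α : Type*} {m m₁ m₂ m0 : MeasurableSpace α}
    {μ : Measure α} [IsProbabilityMeasure μ] {q : ENNReal} (hq : 1 ≤ q) (hmm₂ : m ≤ m₂)
    (hm₁ : m₁ ≤ m0) (hm₂ : m₂ ≤ m0) (hind : ProbabilityTheory.Indep m₁ m μ)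
    {F : α → ℝ} (hF : MemLp F q μ) :
    lpNorm (fun x => (μ[F | m]) x - ∫ z, F z ∂μ) q μ ≤ lpNorm (μ[F | m₂] - μ[F | m₁]) q μ := by
  have h1 : μ[μ[F | m₂] - μ[F | m₁] | m] =ᵐ[μ] fun x => (μ[F | m]) x - ∫ z, F z ∂μ := by
    filter_upwards [condExp_sub (μ := μ) (f := μ[F | m₂]) (g := μ[F | m₁])
        integrable_condExp integrable_condExp m,
      condExp_condExp_of_le (f := F) (μ := μ) hmm₂ hm₂,
      condExp_indep_eq hm₁ (hmm₂.trans hm₂) (stronglyMeasurable_condExp (f := F) (μ := μ)) hind]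
      with x hx hx2 hx1
    rw [hx, Pi.sub_apply, hx2, hx1, integral_condExp hm₁]
  rw [← lpNorm_congr_of_ae_eq h1]
  exact ((hF.condExp hq).sub (hF.condExp hq)).lpNorm_condExp_le_lpNorm hq

/-! ### Conditioning on coordinates of a product space -/

/-- The σ-algebra on a product space generated by the coordinates in `S`. -/
@[reducible]
def coordSigma {n : ℕ} (Ω : Fin n → Type*) [∀ i, MeasurableSpace (Ω i)] (S : Finset (Fin n)) :
    MeasurableSpace ((i : Fin n) → Ω i) :=
  MeasurableSpace.comap (fun ω (i : {i : Fin n // i ∈ S}) => ω i) MeasurableSpace.pi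

section
variable {n : ℕ} {Ω : Fin n → Type*} [∀ i, MeasurableSpace (Ω i)]

lemma measurable_coords (S : Finset (Fin n)) :
    Measurable (fun (ω : (i : Fin n) → Ω i) (i : {i : Fin n // i ∈ S}) => ω i) := by
  fun_prop

lemma coordSigma_le (S : Finset (Fin n)) : coordSigma Ω S ≤ MeasurableSpace.pi :=
  (measurable_coords S).comap_le

lemma coordSigma_mono {S T : Finset (Fin n)} (h : S ⊆ T) : coordSigma Ω S ≤ coordSigma Ω T := by
  have hm : Measurable (fun (x : (i : {i : Fin n // i ∈ T}) → Ω i) (i : {i : Fin n // i ∈ S}) =>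
      x ⟨i, h i.2⟩) := by fun_prop
  rintro _ ⟨t, ht, rfl⟩
  exact ⟨_, hm ht, rfl⟩

variable (P : (i : Fin n) → Measure (Ω i)) [∀ i, IsProbabilityMeasure (P i)]

lemma indep_coordSigma {S T : Finset (Fin n)} (h : Disjoint S T) :
    ProbabilityTheory.Indep (coordSigma Ω S) (coordSigma Ω T) (Measure.pi P) := by
  have hind : ProbabilityTheory.iIndepFun (fun i (ω : (i : Fin n) → Ω i) => ω i)
      (Measure.pi P) :=
    ProbabilityTheory.iIndepFun_pi (X := fun i => (id : Ω i → Ω i)) fun i => aemeasurable_id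
  exact (ProbabilityTheory.IndepFun_iff_Indep _ _ _).1
    (hind.indepFun_finset S T h fun i => measurable_pi_apply i)

lemma measurePreserving_coords (I : Finset (Fin n)) :
    MeasurePreserving (fun (ω : (i : Fin n) → Ω i) (i : {i : Fin n // i ∈ I}) => ω i)
      (Measure.pi P) (Measure.pi fun i : {i : Fin n // i ∈ I} => P i) := by
  have h := measurePreserving_fst.comp (measurePreserving_piEquivPiSubtypeProd P fun i => i ∈ I)
  rwa [Subsingleton.elim (Subtype.fintype fun i => i ∈ I) (Finset.Subtype.fintype I)] at h

lemma measurePreserving_gluePoint (I : Finset (Fin n)) :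
    MeasurePreserving (fun z : ((i : {i : Fin n // i ∈ I}) → Ω i) ×
        ((i : {i : Fin n // i ∉ I}) → Ω i) => gluePoint I z.1 z.2)
      ((Measure.pi fun i : {i : Fin n // i ∈ I} => P i).prod
        (Measure.pi fun i : {i : Fin n // i ∉ I} => P i)) (Measure.pi P) := by
  have h := (measurePreserving_piEquivPiSubtypeProd P fun i => i ∈ I).symm
  rwa [Subsingleton.elim (Subtype.fintype fun i => i ∈ I) (Finset.Subtype.fintype I)] at h

lemma measurableEmbedding_gluePoint (I : Finset (Fin n)) :
    MeasurableEmbedding (fun z : ((i : {i : Fin n // i ∈ I}) → Ω i) ×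
        ((i : {i : Fin n // i ∉ I}) → Ω i) => gluePoint I z.1 z.2) :=
  (MeasurableEquiv.piEquivPiSubtypeProd Ω fun i => i ∈ I).symm.measurableEmbedding

variable {P} {f : ((i : Fin n) → Ω i) → ℝ}

lemma integrable_comp_gluePoint (hf : Integrable f (Measure.pi P)) (I : Finset (Fin n)) :
    Integrable (fun z : ((i : {i : Fin n // i ∈ I}) → Ω i) ×
        ((i : {i : Fin n // i ∉ I}) → Ω i) => f (gluePoint I z.1 z.2))
      ((Measure.pi fun i : {i : Fin n // i ∈ I} => P i).prod
        (Measure.pi fun i : {i : Fin n // i ∉ I} => P i)) :=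
  (measurePreserving_gluePoint P I).integrable_comp_of_integrable hf

lemma ae_integrable_sectionAt (hf : Integrable f (Measure.pi P)) (I : Finset (Fin n)) :
    ∀ᵐ x ∂(Measure.pi fun i : {i : Fin n // i ∈ I} => P i),
      Integrable (sectionAt I f x) (Measure.pi fun i : {i : Fin n // i ∉ I} => P i) :=
  (integrable_comp_gluePoint hf I).prod_right_ae

lemma integrable_integral_sectionAt (hf : Integrable f (Measure.pi P)) (I : Finset (Fin n)) :
    Integrable (fun x => ∫ y, sectionAt I f x y
        ∂(Measure.pi fun i : {i : Fin n // i ∉ I} => P i))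
      (Measure.pi fun i : {i : Fin n // i ∈ I} => P i) :=
  (integrable_comp_gluePoint hf I).integral_prod_left

/-- Integrating out the coordinates outside `I` is conditioning on the coordinates in `I`. -/
lemma integral_sectionAt_ae_eq_condExp (hf : Integrable f (Measure.pi P)) (I : Finset (Fin n)) :
    (fun ω : (i : Fin n) → Ω i => ∫ y, sectionAt I f (fun i => ω i) y
        ∂(Measure.pi fun i : {i : Fin n // i ∉ I} => P i))
      =ᵐ[Measure.pi P] (Measure.pi P)[f | coordSigma Ω I] := by
  have hg := integrable_integral_sectionAt hf I
  have hr := measurePreserving_coords P I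
  refine ae_eq_condExp_of_forall_setIntegral_eq (coordSigma_le I) hf
    (fun s _ _ => (hr.integrable_comp_of_integrable hg).integrableOn) ?_ ?_
  · rintro _ ⟨t, ht, rfl⟩ -
    rw [← (measurePreserving_gluePoint P I).setIntegral_preimage_emb
      (measurableEmbedding_gluePoint I) f]
    have hpre : (fun z : ((i : {i : Fin n // i ∈ I}) → Ω i) ×
        ((i : {i : Fin n // i ∉ I}) → Ω i) => gluePoint I z.1 z.2) ⁻¹'
        ((fun ω (i : {i : Fin n // i ∈ I}) => ω i) ⁻¹' t) = t ×ˢ Set.univ := by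
      ext z
      have : (fun i : {i : Fin n // i ∈ I} => gluePoint I z.1 z.2 i) = z.1 := by
        funext i; simp [gluePoint]
      simp [this]
    rw [hpre, setIntegral_prod _ (integrable_comp_gluePoint hf I).integrableOn]
    simp only [Measure.restrict_univ]
    rw [← integral_indicator (hr.measurable ht), ← integral_indicator ht, ← hr.map_eq,
      integral_map hr.measurable.aemeasurable]
    · rfl
    · rw [hr.map_eq]
      exact (hg.indicator ht).1
  · refine ⟨hg.1.mk _ ∘ fun ω i => ω i, hg.1.stronglyMeasurable_mk.comp_measurable
      (comap_measurable _), ?_⟩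
    exact hr.quasiMeasurePreserving.ae_eq_comp hg.1.ae_eq_mk

/-- Markov's inequality for the averages of the sections: an `L_p` bound `δ` on the deviation gives
exceptional probability at most `(δ / ε) ^ p`, which equals `ε` for `δ = ε ^ ((p + 1) / p)`. -/
lemma one_sub_le_measureReal_sectionAt {ε p : ℝ} (hε : 0 < ε) (hp1 : 1 < p)
    (hf : MemLp f (ENNReal.ofReal p) (Measure.pi P)) (I : Finset (Fin n))
    (h : lpNorm (fun ω => ((Measure.pi P)[f | coordSigma Ω I]) ω - ∫ z, f z ∂(Measure.pi P))
      (ENNReal.ofReal p) (Measure.pi P) ≤ ε ^ ((p + 1) / p)) :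
    1 - ε ≤ (Measure.pi (fun i : {i : Fin n // i ∈ I} => P i)).real
      {x | Integrable (sectionAt I f x) (Measure.pi (fun i : {i : Fin n // i ∉ I} => P i)) ∧
        |(∫ y, sectionAt I f x y ∂(Measure.pi (fun i : {i : Fin n // i ∉ I} => P i)))
          - ∫ z, f z ∂(Measure.pi P)| ≤ ε} := by
  have hq : 1 ≤ ENNReal.ofReal p := by simpa using hp1.le
  have hp0 : 0 < p := by linarith
  have hint := hf.integrable hq
  have hr := measurePreserving_coords P I
  have hg := integrable_integral_sectionAt hint I
  set c := ∫ z, f z ∂(Measure.pi P)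
  set g := fun x => ∫ y, sectionAt I f x y
        ∂(Measure.pi fun i : {i : Fin n // i ∉ I} => P i)
  set ν := Measure.pi fun i : {i : Fin n // i ∈ I} => P i
  have hgm : AEStronglyMeasurable (fun x => g x - c) ν := hg.1.sub aestronglyMeasurable_const
  have hnorm : eLpNorm (fun x => g x - c) (ENNReal.ofReal p) ν
      ≤ ENNReal.ofReal (ε ^ ((p + 1) / p)) := by
    rw [← eLpNorm_comp_measurePreserving hgm hr]
    have hae : (fun x => g x - c) ∘ (fun (ω : (i : Fin n) → Ω i) (i : {i : Fin n // i ∈ I}) => ω i)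
        =ᵐ[Measure.pi P] fun ω => ((Measure.pi P)[f | coordSigma Ω I]) ω - c := by
      filter_upwards [integral_sectionAt_ae_eq_condExp hint I] with ω hω
      rw [← hω]
      rfl
    have hmem : MemLp (fun ω => ((Measure.pi P)[f | coordSigma Ω I]) ω - c) (ENNReal.ofReal p)
        (Measure.pi P) := (hf.condExp hq).sub (memLp_const c)
    rw [eLpNorm_congr_ae hae, ← ofReal_lpNorm hmem]
    exact ENNReal.ofReal_le_ofReal h
  have hcheb : ν.real {x | ε ≤ |g x - c|} ≤ ε := by
    have h1 := mul_meas_ge_le_pow_eLpNorm' ν (by simpa using hp0) ENNReal.ofReal_ne_top hgm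
      (ENNReal.ofReal ε)
    rw [ENNReal.toReal_ofReal hp0.le] at h1
    have h2 := h1.trans (ENNReal.rpow_le_rpow hnorm hp0.le)
    rw [ENNReal.ofReal_rpow_of_pos hε, ENNReal.ofReal_rpow_of_pos (by positivity),
      ← Real.rpow_mul hε.le, div_mul_cancel₀ _ hp0.ne', Real.rpow_add_one hε.ne',
      ENNReal.ofReal_mul (by positivity)] at h2
    have h3 := (ENNReal.mul_le_mul_iff_right
      (by simpa using Real.rpow_pos_of_pos hε p) ENNReal.ofReal_ne_top).1 h2
    have hset : {x | ε ≤ |g x - c|} = {x | ENNReal.ofReal ε ≤ ‖g x - c‖ₑ} := by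
      ext x
      simp only [Set.mem_ofPred_eq]
      rw [← ofReal_norm, ENNReal.ofReal_le_ofReal_iff (norm_nonneg _), Real.norm_eq_abs]
    rw [hset]
    exact ENNReal.toReal_le_of_le_ofReal hε.le h3
  set T := {x | Integrable (sectionAt I f x)
    (Measure.pi (fun i : {i : Fin n // i ∉ I} => P i)) ∧ |g x - c| ≤ ε}
  have hnull : ν.real {x | ¬ Integrable (sectionAt I f x)
      (Measure.pi (fun i : {i : Fin n // i ∉ I} => P i))} = 0 := by
    rw [measureReal_def, ae_iff.1 (ae_integrable_sectionAt hint I)]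
    rfl
  have hcover : (Set.univ : Set ((i : {i : Fin n // i ∈ I}) → Ω i)) ⊆
      T ∪ ({x | ¬ Integrable (sectionAt I f x)
        (Measure.pi (fun i : {i : Fin n // i ∉ I} => P i))} ∪ {x | ε ≤ |g x - c|}) := by
    intro x _
    by_cases hx : Integrable (sectionAt I f x)
        (Measure.pi (fun i : {i : Fin n // i ∉ I} => P i))
    · rcases le_total |g x - c| ε with hx' | hx'
      · exact Or.inl ⟨hx, hx'⟩
      · exact Or.inr (Or.inr hx')
    · exact Or.inr (Or.inl hx)
  have h1 : (1 : ℝ) ≤ _ := (probReal_univ (μ := ν)).symm.le.trans (measureReal_mono hcover)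
  have h2 := measureReal_union_le (μ := ν) T ({x | ¬ Integrable (sectionAt I f x)
        (Measure.pi (fun i : {i : Fin n // i ∉ I} => P i))} ∪ {x | ε ≤ |g x - c|})
  have h3 := measureReal_union_le (μ := ν) {x | ¬ Integrable (sectionAt I f x)
        (Measure.pi (fun i : {i : Fin n // i ∉ I} => P i))} {x | ε ≤ |g x - c|}
  linarith

end

/-! ### Choice of the block -/

/-- The number of blocks `m` is the least integer that is at least `1 / (4 * c)` and at least `2`.
As `1 / (4 * c) ≥ 1`, rounding up at most doubles it, so blocks of length `n / m` have length at
least `2 * c * n - 1 ≥ c * n`. -/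
lemma exists_number_of_blocks {c : ℝ} (hc : 0 < c) (hc4 : c ≤ 1 / 4) {n : ℕ}
    (hn : 2 / c ≤ (n : ℝ)) :
    ∃ m L : ℕ, 2 ≤ m ∧ 0 < L ∧ m * L ≤ n ∧ 1 / (4 * c) ≤ m ∧ c * n ≤ L := by
  set t := 1 / (4 * c) with ht
  have ht1 : 1 ≤ t := by rw [ht, le_div_iff₀ (by positivity)]; linarith
  have htc : t * (4 * c) = 1 := by rw [ht]; field_simp
  have hn' : 2 ≤ n * c := by rwa [div_le_iff₀ hc] at hn
  set m := max 2 ⌈t⌉₊ with hm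
  have hm2 : 2 ≤ m := le_max_left _ _
  have htm : t ≤ m := (Nat.le_ceil t).trans (by exact_mod_cast le_max_right 2 ⌈t⌉₊)
  have hmt : (m : ℝ) ≤ 2 * t := by
    rw [hm, Nat.cast_max]
    refine max_le (by push_cast; linarith) ?_
    have := Nat.ceil_lt_add_one (zero_le_one.trans ht1)
    linarith
  have hL : c * n ≤ (n / m : ℕ) := by
    have h1 : (n : ℝ) < m * ((n / m : ℕ) + 1) := by
      exact_mod_cast Nat.lt_mul_div_succ n (by omega)
    have h2 : (n : ℝ) ≤ 2 * t * ((n / m : ℕ) + 1) :=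
      h1.le.trans (mul_le_mul_of_nonneg_right hmt (by positivity))
    have h3 : (n : ℝ) * (2 * c) ≤ (n / m : ℕ) + 1 := by
      have := mul_le_mul_of_nonneg_right h2 (by positivity : 0 ≤ 2 * c)
      calc _ ≤ _ := this
        _ = t * (4 * c) * ((n / m : ℕ) + 1) := by ring
        _ = _ := by rw [htc, one_mul]
    linarith
  refine ⟨m, n / m, hm2, ?_, Nat.mul_div_le n m, htm, hL⟩
  have : (0 : ℝ) < (n / m : ℕ) := by linarith
  exact_mod_cast this

theorem theorem1 (ε p : ℝ) (hε0 : 0 < ε) (hε1 : ε ≤ 1) (hp1 : 1 < p) (hp2 : p ≤ 2)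
    (n : ℕ) (hn : 2 / concConst ε p ≤ (n : ℝ))
    (Ω : Fin n → Type*) [∀ i, MeasurableSpace (Ω i)]
    (P : (i : Fin n) → Measure (Ω i)) [∀ i, IsProbabilityMeasure (P i)]
    (f : ((i : Fin n) → Ω i) → ℝ)
    (hf : MemLp f (ENNReal.ofReal p) (Measure.pi P))
    (hf1 : eLpNorm f (ENNReal.ofReal p) (Measure.pi P) ≤ 1) :
    ∃ J : Finset (Fin n), (∃ a b : Fin n, J = Finset.Icc a b) ∧ Jᶜ.Nonempty ∧
      concConst ε p * (n : ℝ) ≤ (J.card : ℝ) ∧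
      ∀ I : Finset (Fin n), I.Nonempty → I ⊆ J →
        1 - ε ≤ (Measure.pi (fun i : {i : Fin n // i ∈ I} => P i)).real
          {x | Integrable (sectionAt I f x) (Measure.pi (fun i : {i : Fin n // i ∉ I} => P i)) ∧
            |(∫ y, sectionAt I f x y ∂(Measure.pi (fun i : {i : Fin n // i ∉ I} => P i)))
              - ∫ z, f z ∂(Measure.pi P)| ≤ ε} := by
  have hp0 : 0 < p := by linarith
  have hq : 1 ≤ ENNReal.ofReal p := by simpa using hp1.le
  have hδ : 0 < ε ^ ((p + 1) / p) := Real.rpow_pos_of_pos hε0 _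
  have hc : concConst ε p = 1 / 4 * (ε ^ ((p + 1) / p)) ^ 2 * (p - 1) := by
    rw [concConst, ← Real.rpow_natCast, ← Real.rpow_mul hε0.le]
    congr 3
    push_cast
    ring
  have hc0 : 0 < concConst ε p := by
    rw [hc]
    have : 0 < p - 1 := by linarith
    positivity
  have hc4 : concConst ε p ≤ 1 / 4 := by
    have h1 : ε ^ ((p + 1) / p) ≤ 1 := Real.rpow_le_one hε0.le hε1 (by positivity)
    have h2 : (ε ^ ((p + 1) / p)) ^ 2 ≤ 1 := pow_le_one₀ hδ.le h1
    rw [hc]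
    nlinarith
  obtain ⟨m, L, hm2, hL0, hmL, hcm, hcL⟩ := exists_number_of_blocks hc0 hc4 hn
  obtain ⟨k, hkm, hk⟩ := exists_lpNorm_condExp_sub_sq_le hp1 hp2 (μ := Measure.pi P)
    (G := fun k => coordSigma Ω (Finset.univ.filter fun i : Fin n => (i : ℕ) < k * L))
    (fun k l hkl => coordSigma_mono fun i hi => by
      simp only [Finset.mem_filter, Finset.mem_univ, true_and] at hi ⊢
      exact hi.trans_le (Nat.mul_le_mul_right L hkl))
    (fun k => coordSigma_le _) hf (m := m) (by omega)
  -- The interval `J` is the block `[k * L, (k + 1) * L)`.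
  have hkL : (k + 1) * L ≤ n := (Nat.mul_le_mul_right L hkm).trans hmL
  have hkL' : (k + 1) * L = k * L + L := by ring
  have hinc : lpNorm ((Measure.pi P)[f | coordSigma Ω
        (Finset.univ.filter fun i : Fin n => (i : ℕ) < (k + 1) * L)]
      - (Measure.pi P)[f | coordSigma Ω
        (Finset.univ.filter fun i : Fin n => (i : ℕ) < k * L)])
      (ENNReal.ofReal p) (Measure.pi P) ≤ ε ^ ((p + 1) / p) := by
    have hf1' : lpNorm f (ENNReal.ofReal p) (Measure.pi P) ≤ 1 := by
      rw [← toReal_eLpNorm hf.1]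
      exact ENNReal.toReal_le_of_le_ofReal zero_le_one (by simpa using hf1)
    have h1 := hk.trans (pow_le_one₀ lpNorm_nonneg hf1')
    have h2 : 1 ≤ (p - 1) * m * (ε ^ ((p + 1) / p)) ^ 2 := by
      rw [div_le_iff₀ (by positivity), hc] at hcm
      linarith
    have h3 : 0 < (p - 1) * m := by
      have : 0 < p - 1 := by linarith
      positivity
    exact le_of_sq_le_sq (le_of_mul_le_mul_left (h1.trans h2) h3) hδ.le
  refine ⟨Finset.Icc ⟨k * L, by omega⟩ ⟨(k + 1) * L - 1, by omega⟩, ⟨_, _, rfl⟩, ?_, ?_, ?_⟩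
  · -- There are at least two blocks, so one block is not everything.
    have h2L : 2 * L ≤ n := (Nat.mul_le_mul_right L hm2).trans hmL
    rw [Finset.nonempty_iff_ne_empty, ne_eq, Finset.compl_eq_empty_iff]
    intro h
    have hcard := congrArg Finset.card h
    rw [Fin.card_Icc, Finset.card_univ, Fintype.card_fin] at hcard
    simp only at hcard
    omega
  · rw [Fin.card_Icc]
    simp only
    rwa [show (k + 1) * L - 1 + 1 - k * L = L by omega]
  · intro I _ hIJ
    have hI : ∀ i ∈ I, k * L ≤ (i : ℕ) ∧ (i : ℕ) < (k + 1) * L := fun i hi => by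
      have := Finset.mem_Icc.1 (hIJ hi)
      simp only [Fin.le_def] at this
      omega
    refine one_sub_le_measureReal_sectionAt hε0 hp1 hf I (le_trans ?_ hinc)
    refine lpNorm_condExp_sub_integral_le hq (coordSigma_mono fun i hi => ?_)
      (coordSigma_le _) (coordSigma_le _) (indep_coordSigma P ?_) hf
    · simpa using (hI i hi).2
    · rw [Finset.disjoint_left]
      intro i hi hi'
      simp only [Finset.mem_filter, Finset.mem_univ, true_and] at hi
      have := (hI i hi').1
      omega
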